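/- Let $n \ge 4$ and let $\Gamma_n$ be the derangement graph, i.e. the Cayley graph of the symmetric group $S_n$ whose connection set is the set of all derangements (permutations of $\{1,\dots,n\}$ with no fixed point); equivalently, the vertices of $\Gamma_n$ are the $n!$ permutations of $\{1,\dots,n\}$, and $g,h$ are adjacent if and only if $g(i)\neq h(i)$ for all $i\in\{1,\dots,n\}$. Then $\Gamma_n$ is vertex pancyclic, that is, for every integer $k$ with $3\le k\le n!$, every vertex of $\Gamma_n$ lies on a cycle of length $k$; and hence $\Gamma_n$ is pancyclic, that is, it contains a cycle of every length $k$ with $3\le k\le n!$. -/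

import Mathlib

/-- A graph of finite order at least `3` is pancyclic if it contains a cycle of every length
from `3` to its order. -/
def SimpleGraph.IsPancyclic {V : Type*} [Fintype V] (G : SimpleGraph V) : Prop :=
  3 ≤ Fintype.card V ∧
    ∀ k : ℕ, 3 ≤ k → k ≤ Fintype.card V → ∃ (u : V) (c : G.Walk u u), c.IsCycle ∧ c.length = k

/-- A graph of finite order at least `3` is vertex pancyclic if every vertex lies on a cycle of
each length from `3` to its order. -/
def SimpleGraph.IsVertexPancyclic {V : Type*} [Fintype V] (G : SimpleGraph V) : Prop :=
  3 ≤ Fintype.card V ∧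
    ∀ v : V, ∀ k : ℕ, 3 ≤ k → k ≤ Fintype.card V →
      ∃ (u : V) (c : G.Walk u u), c.IsCycle ∧ c.length = k ∧ v ∈ c.support

/-- The derangement graph: the Cayley graph of the symmetric group on `n` points whose
connection set is the set of all derangements (permutations without fixed points). -/
def derangementGraph (n : ℕ) : SimpleGraph (Equiv.Perm (Fin n)) :=
  SimpleGraph.mulCayley (derangements (Fin n))

/-- Two permutations are adjacent in the derangement graph if and only if they differ at every
point (for `n = 0` the graph is a single vertex without edges). -/
theorem derangementGraph_adj {n : ℕ} (hn : 0 < n) (g h : Equiv.Perm (Fin n)) :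
    (derangementGraph n).Adj g h ↔ ∀ i, g i ≠ h i := by
  rw [derangementGraph, SimpleGraph.mulCayley_adj']
  constructor
  · rintro ⟨-, s, hs, rfl | rfl⟩ i hi
    · exact hs i (g.injective hi).symm
    · exact hs i (h.injective hi)
  · intro H
    refine ⟨fun e => H ⟨0, hn⟩ (by rw [e]), g⁻¹ * h, fun i hi => H i ?_, Or.inl (by group)⟩
    rw [Equiv.Perm.mul_apply, Equiv.Perm.inv_eq_iff_eq] at hi
    exact hi.symm

/-- Since the set of derangements is closed under conjugation, multiplying by derangements on
the left gives the same Cayley graph as multiplying on the right. -/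
theorem derangementGraph_adj_iff_left {n : ℕ} (hn : 0 < n) (g h : Equiv.Perm (Fin n)) :
    (derangementGraph n).Adj g h ↔ ∃ s ∈ derangements (Fin n), h = s * g := by
  rw [derangementGraph_adj hn]
  constructor
  · intro H
    refine ⟨h * g⁻¹, fun i hi => H (g⁻¹ i) ?_, by group⟩
    rw [Equiv.Perm.mul_apply] at hi
    rw [hi]; simp
  · rintro ⟨s, hs, rfl⟩ i hi
    exact hs (g i) hi.symm

/-! The left cosets of the group of translations of `Fin n` partition the permutations into
`n`-cliques. If `g` and `g * swap i (i + 1)` lie in distinct cosets, these are linked; a coset has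
at most `n` neighbours, and adjacent transpositions generate the group, so the cosets are connected.
Two vertices of a coset have distinct neighbours in each linked coset
(`isCliqueLinkage_derangementGraph`). A cycle is grown clique by clique. A step inside a clique is
replaced by a detour along an edge of a linked new clique (`attach`), which is then filled one
vertex at a time (`grow`). A filled clique keeps an inner step for each neighbour still to be
attached. Attaching adds two vertices at once; the skipped length comes from attaching one vertex
early (`exists_card_eq`). Left multiplication moves a cycle to any vertex. -/

/-! ### Inserting a point into a cyclic permutation. -/

namespace Equiv.Perm

variable {α : Type*} [DecidableEq α] {f : Perm α} {x v : α}

/-- Composing a permutation with the transposition of a moved point and a fixed point inserts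
the fixed point behind the moved point. -/
theorem mul_swap_apply_of_fixed (hv : f v = v) (y : α) :
    (f * swap x v) y = if y = x then v else if y = v then f x else f y := by
  simp only [mul_apply, swap_apply_def]
  split_ifs <;> simp_all

variable [Fintype α]

theorem support_mul_swap_of_fixed (hx : x ∈ f.support) (hv : v ∉ f.support) :
    (f * swap x v).support = insert v f.support := by
  rw [mem_support] at hx
  rw [notMem_support] at hv
  ext y
  rw [mem_support, Finset.mem_insert, mem_support, mul_swap_apply_of_fixed hv]
  have hxv : x ≠ v := by rintro rfl; exact hx hv
  split_ifs with h1 h2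
  · subst h1; simp [hx, hxv.symm]
  · subst h2
    simp only [ne_eq, true_or, iff_true]
    intro h
    exact hxv (f.injective (h.trans hv.symm))
  · simp [h2]

theorem IsCycle.mul_swap_of_fixed (hf : f.IsCycle) (hx : x ∈ f.support) (hv : v ∉ f.support) :
    (f * swap x v).IsCycle := by
  have hsupp := support_mul_swap_of_fixed hx hv
  have hv' := notMem_support.1 hv
  have happ := mul_swap_apply_of_fixed (x := x) hv'
  have hxv : x ≠ v := by rintro rfl; exact hv hx
  have key : ∀ i : ℕ, (f * swap x v).SameCycle x ((f ^ i) x) := by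
    intro i
    induction i with
    | zero => exact SameCycle.refl _ _
    | succ i ih =>
      rw [pow_succ', mul_apply]
      by_cases hz : (f ^ i) x = x
      · have h : (f * swap x v) ((f * swap x v) x) = f ((f ^ i) x) := by
          rw [happ x, if_pos rfl, happ v, if_neg hxv.symm, if_pos rfl, hz]
        rw [← h, sameCycle_apply_right, sameCycle_apply_right]
      · have hzv : (f ^ i) x ≠ v := by
          intro h
          have : (f ^ i) x ∈ f.support := pow_apply_mem_support.2 hx
          exact hv (h ▸ this)
        have h : (f * swap x v) ((f ^ i) x) = f ((f ^ i) x) := by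
          rw [happ, if_neg hz, if_neg hzv]
        rw [← h, sameCycle_apply_right]
        exact ih
  refine ⟨x, mem_support.1 (hsupp ▸ Finset.mem_insert_of_mem hx), fun y hy => ?_⟩
  rw [← mem_support, hsupp, Finset.mem_insert] at hy
  rcases hy with rfl | hy
  · have h : (f * swap x y) x = y := by rw [happ, if_pos rfl]
    conv_rhs => rw [← h]
    exact sameCycle_apply_right.2 (SameCycle.refl _ _)
  · obtain ⟨i, rfl⟩ := hf.exists_pow_eq (mem_support.1 hx) (mem_support.1 hy)
    exact key i

end Equiv.Perm

/-! ### Cycles of a graph as cyclic permutations. -/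

namespace SimpleGraph

open Equiv Equiv.Perm Finset

variable {V W : Type*} [DecidableEq V] [Fintype V] {G : SimpleGraph V}

/-- A cyclic permutation all of whose steps are edges of `G`. -/
def IsCyclicPerm (G : SimpleGraph V) (f : Perm V) : Prop :=
  f.IsCycle ∧ ∀ y ∈ f.support, G.Adj y (f y)

theorem IsCyclicPerm.exists_isCycle {f : Perm V} (hf : G.IsCyclicPerm f) (h3 : 3 ≤ #f.support) :
    ∃ (u : V) (c : G.Walk u u), c.IsCycle ∧ c.length = #f.support := by
  obtain ⟨hc, hadj⟩ := hf
  obtain ⟨x, hx⟩ := hc.nonempty_support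
  have hord := hc.orderOf
  have hmem : ∀ j : ℕ, (f ^ j) x ∈ f.support := fun j => pow_apply_mem_support.2 hx
  have hinj : ∀ i j : ℕ, 1 ≤ i → i < j → j ≤ #f.support → (f ^ i) x ≠ (f ^ j) x := by
    intro i j hi hij hj h
    have h' : (f ^ i) ((f ^ (j - i)) x) = (f ^ i) x := by
      rw [← mul_apply, ← pow_add, Nat.add_sub_cancel' hij.le, h]
    have h'' := (hc.pow_eq_one_iff' (Perm.mem_support.1 hx)).2 ((f ^ i).injective h')
    have := Nat.le_of_dvd (by omega) (orderOf_dvd_of_pow_eq_one h'')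
    omega
  -- The path starts at `f x`, so that prepending the edge from `x` to `f x` closes the cycle.
  have key : ∀ i : ℕ, i + 1 ≤ #f.support → ∃ p : G.Walk (f x) ((f ^ (i + 1)) x),
      p.IsPath ∧ p.length = i ∧ ∀ z ∈ p.support, ∃ j, 1 ≤ j ∧ j ≤ i + 1 ∧ (f ^ j) x = z := by
    intro i
    induction i with
    | zero =>
      intro _
      exact ⟨Walk.nil.copy rfl (by simp), by simp, by simp, fun z hz => ⟨1, by simp_all⟩⟩
    | succ i ih =>
      intro hi
      obtain ⟨p, hp, hl, hs⟩ := ih (by omega)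
      have ha : G.Adj ((f ^ (i + 1)) x) ((f ^ (i + 1 + 1)) x) := by
        rw [pow_succ' f (i + 1), mul_apply]
        exact hadj _ (hmem _)
      refine ⟨p.concat ha, hp.concat (fun hz => ?_) ha, by simp [hl], fun z hz => ?_⟩
      · obtain ⟨j, h1, h2, h3⟩ := hs _ hz
        exact hinj j (i + 1 + 1) h1 (by omega) hi h3
      · rw [Walk.support_concat] at hz
        simp only [List.mem_append, List.mem_singleton] at hz
        rcases hz with hz | hz
        · obtain ⟨j, h1, h2, h3⟩ := hs z hz
          exact ⟨j, h1, by omega, h3⟩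
        · exact ⟨i + 1 + 1, by omega, le_rfl, hz.symm⟩
  obtain ⟨p, hp, hl, -⟩ := key (#f.support - 1) (by omega)
  have hend : (f ^ (#f.support - 1 + 1)) x = x := by
    rw [Nat.sub_add_cancel (by omega), ← hord, pow_orderOf_eq_one, one_apply]
  refine ⟨x, Walk.cons (hadj x hx) (p.copy rfl hend), ?_, ?_⟩
  · rw [Walk.isCycle_iff_isPath_tail_and_le_length]
    refine ⟨by simpa using hp, ?_⟩
    simp [hl]; omega
  · simp [hl]; omega

variable [DecidableEq W] (π : V → W)

/-- The moved points `y` such that the step from `y` to `f y` stays in the fibre of `π` over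
`w`. -/
def innerSteps (f : Perm V) (w : W) : Finset V :=
  {y ∈ f.support | π y = w ∧ π (f y) = w}

variable {π}

theorem mem_innerSteps {f : Perm V} {w : W} {y : V} :
    y ∈ innerSteps π f w ↔ y ∈ f.support ∧ π y = w ∧ π (f y) = w := by
  simp [innerSteps]

theorem IsCyclicPerm.insert_vertex {f : Perm V} (hf : G.IsCyclicPerm f) {x v : V}
    (hx : x ∈ f.support) (hv : v ∉ f.support) (h1 : G.Adj x v) (h2 : G.Adj v (f x)) :
    G.IsCyclicPerm (f * swap x v) := by
  refine ⟨hf.1.mul_swap_of_fixed hx hv, fun y hy => ?_⟩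
  rw [support_mul_swap_of_fixed hx hv, Finset.mem_insert] at hy
  rw [mul_swap_apply_of_fixed (notMem_support.1 hv)]
  split_ifs with h h'
  · exact h ▸ h1
  · exact h' ▸ h2
  · exact hf.2 y (hy.resolve_left h')

/-- Inserting `b` and then `a` behind `x` gives `x → a → b → f x`. The intermediate permutation need
not follow edges of `G`, as `x` and `b` may be non-adjacent. Only the inner step at `x` is lost. -/
theorem IsCyclicPerm.insert_edge {f : Perm V} (hf : G.IsCyclicPerm f) {x a b : V} {Q R : W}
    (hx : x ∈ innerSteps π f Q) (ha : a ∉ f.support) (hb : b ∉ f.support)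
    (hab : G.Adj a b) (hπa : π a = R) (hπb : π b = R) (hxa : G.Adj x a) (hbx : G.Adj b (f x)) :
    ∃ f' : Perm V, G.IsCyclicPerm f' ∧ f'.support = insert a (insert b f.support) ∧
      (∀ w, (innerSteps π f w).erase x ⊆ innerSteps π f' w) ∧ a ∈ innerSteps π f' R := by
  obtain ⟨hxs, hxQ, hfxQ⟩ := mem_innerSteps.1 hx
  have hne := hab.ne
  have hxa' : x ≠ a := hxa.ne
  have hxb' : x ≠ b := by rintro rfl; exact hb hxs
  have hs1 := support_mul_swap_of_fixed hxs hb
  have ha1 : a ∉ (f * swap x b).support := by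
    rw [hs1, Finset.mem_insert]; tauto
  have hx1 : x ∈ (f * swap x b).support := by rw [hs1]; exact Finset.mem_insert_of_mem hxs
  have hs2 := support_mul_swap_of_fixed hx1 ha1
  rw [hs1] at hs2
  have happ : ∀ y, (f * swap x b * swap x a) y =
      if y = x then a else if y = a then b else if y = b then f x else f y := by
    intro y
    rw [mul_swap_apply_of_fixed (notMem_support.1 ha1),
      mul_swap_apply_of_fixed (notMem_support.1 hb), mul_swap_apply_of_fixed (notMem_support.1 hb)]
    split_ifs <;> simp_all
  refine ⟨f * swap x b * swap x a, ⟨(hf.1.mul_swap_of_fixed hxs hb).mul_swap_of_fixed hx1 ha1,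
    fun y hy => ?_⟩, hs2, fun w y hy => ?_, ?_⟩
  · rw [hs2, Finset.mem_insert, Finset.mem_insert] at hy
    rw [happ]
    split_ifs with h1 h2 h3
    · exact h1 ▸ hxa
    · exact h2 ▸ hab
    · exact h3 ▸ hbx
    · exact hf.2 y (by tauto)
  · rw [Finset.mem_erase, mem_innerSteps] at hy
    obtain ⟨hyx, hys, hy1, hy2⟩ := hy
    have hya : y ≠ a := by rintro rfl; exact ha hys
    have hyb : y ≠ b := by rintro rfl; exact hb hys
    rw [mem_innerSteps, hs2, happ, if_neg hyx, if_neg hya, if_neg hyb]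
    exact ⟨by simp [hys], hy1, hy2⟩
  · rw [mem_innerSteps, hs2, happ, if_neg hxa'.symm, if_pos rfl]
    exact ⟨by simp, hπa, hπb⟩

end SimpleGraph

/-! ### Growing a cycle through linked cliques. -/

namespace SimpleGraph

open Equiv Equiv.Perm Finset

variable {V W : Type*} [Fintype V] [DecidableEq W] [Fintype W]

open Classical in
/-- A partition of the vertices of `G` into cliques of size `n`, the fibres of `π`, together with
a symmetric connected relation on the cliques that has degrees at most `n` and such that distinct
vertices of a clique have distinct neighbours in each related clique. -/
structure IsCliqueLinkage (G : SimpleGraph V) (π : V → W) (r : W → W → Prop) (n : ℕ) : Prop where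
  card_fiber : ∀ w, #{v | π v = w} = n
  adj_of_eq : ∀ {u v}, π u = π v → u ≠ v → G.Adj u v
  symm : ∀ {w w'}, r w w' → r w' w
  degree_le : ∀ w, #{w' | r w w'} ≤ n
  exists_rel : ∀ S : Finset W, S.Nonempty → S ≠ univ → ∃ Q ∈ S, ∃ R ∉ S, r Q R
  exists_adj : ∀ {R x y}, r (π x) R → π x = π y → x ≠ y →
    ∃ a b, π a = R ∧ π b = R ∧ a ≠ b ∧ G.Adj x a ∧ G.Adj y b

variable {G : SimpleGraph V} {π : V → W} {r : W → W → Prop} {n : ℕ} {S : Finset W} {R : W}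

theorem IsCliqueLinkage.card_preimage (h : G.IsCliqueLinkage π r n) (S : Finset W) :
    #{v | π v ∈ S} = n * #S := by
  have := card_eq_sum_card_fiberwise (f := π) (s := ({v | π v ∈ S} : Finset V)) (t := S)
    (fun v hv => by simpa using hv)
  rw [this, sum_congr rfl (g := fun _ => n), sum_const, smul_eq_mul, mul_comm]
  intro w hw
  rw [← h.card_fiber w]
  congr 1
  ext v
  simp only [mem_filter, mem_univ, true_and, and_iff_right_iff_imp]
  rintro rfl
  exact hw

variable [DecidableEq V]

open Classical in
/-- A cycle through all vertices of the cliques in `S` that has, in each of them, at least as many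
inner steps as the clique has neighbours outside `S`. -/
structure IsFullCycle (G : SimpleGraph V) (π : V → W) (r : W → W → Prop) (S : Finset W)
    (f : Perm V) : Prop where
  isCyclicPerm : G.IsCyclicPerm f
  mem_support : ∀ y, y ∈ f.support ↔ π y ∈ S
  card_le : ∀ w ∈ S, #{w' | r w w' ∧ w' ∉ S} ≤ #(innerSteps π f w)

open Classical in
/-- A cycle through all vertices of the cliques in `S` and `k` vertices of a further clique `R`,
of which at most `d` begin a step that leaves `R`. -/
structure IsPartialCycle (G : SimpleGraph V) (π : V → W) (r : W → W → Prop) (S : Finset W)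
    (R : W) (d k : ℕ) (f : Perm V) : Prop where
  isCyclicPerm : G.IsCyclicPerm f
  notMem : R ∉ S
  mem_of_mem_support : ∀ y ∈ f.support, π y ∈ insert R S
  mem_support : ∀ y, π y ∈ S → y ∈ f.support
  card_support : #{y ∈ f.support | π y = R} = k
  card_le_add : k ≤ #(innerSteps π f R) + d
  card_le : ∀ w ∈ S, #{w' | r w w' ∧ w' ∉ insert R S} ≤ #(innerSteps π f w)

variable {d k : ℕ} {f : Perm V}

theorem IsPartialCycle.card_support_eq (h : G.IsCliqueLinkage π r n)
    (hf : G.IsPartialCycle π r S R d k f) : #f.support = n * #S + k := by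
  rw [← h.card_preimage S, ← hf.card_support, ← card_union_of_disjoint]
  · congr 1
    ext y
    have h1 := hf.mem_of_mem_support y
    have h2 := hf.mem_support y
    simp only [mem_union, mem_filter, mem_univ, true_and, Finset.mem_insert] at h1 ⊢
    tauto
  · rw [Finset.disjoint_left]
    intro y hy hy'
    simp only [mem_filter, mem_univ, true_and] at hy hy'
    exact hf.notMem (hy'.2 ▸ hy)

/-- A new vertex of `R` splits an inner step of `R` into two inner steps, so the number of steps
leaving `R` does not grow. -/
theorem IsPartialCycle.grow (h : G.IsCliqueLinkage π r n) (hf : G.IsPartialCycle π r S R d k f)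
    (hd : d < k) (hk : k < n) : ∃ f', G.IsPartialCycle π r S R d (k + 1) f' := by
  have hpos : 0 < #(innerSteps π f R) := by have := hf.card_le_add; omega
  obtain ⟨x, hx⟩ := card_pos.1 hpos
  obtain ⟨hxs, hxR, hfxR⟩ := mem_innerSteps.1 hx
  have hlt : #{y ∈ f.support | π y = R} < #{y | π y = R} := by
    rw [hf.card_support, h.card_fiber]; exact hk
  obtain ⟨v, hv, hv'⟩ := exists_mem_notMem_of_card_lt_card hlt
  simp only [mem_filter, mem_univ, true_and] at hv hv'
  replace hv' : v ∉ f.support := fun hs => hv' ⟨hs, hv⟩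
  have happ := mul_swap_apply_of_fixed (x := x) (notMem_support.1 hv')
  have hsupp := support_mul_swap_of_fixed hxs hv'
  have hxv : x ≠ v := by rintro rfl; exact hv' hxs
  have hvf : v ≠ f x := by rintro rfl; exact hv' (apply_mem_support.2 hxs)
  have hsub : ∀ w, innerSteps π f w ⊆ innerSteps π (f * swap x v) w := by
    intro w y hy
    rw [mem_innerSteps] at hy ⊢
    rw [hsupp, happ]
    refine ⟨Finset.mem_insert_of_mem hy.1, hy.2.1, ?_⟩
    split_ifs with h1 h2
    · rw [hv, ← hy.2.1, h1, hxR]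
    · exact absurd hy.1 (h2 ▸ hv')
    · exact hy.2.2
  refine ⟨f * swap x v, hf.isCyclicPerm.insert_vertex hxs hv' (h.adj_of_eq (by rw [hxR, hv]) hxv)
    (h.adj_of_eq (by rw [hfxR, hv]) hvf), hf.notMem, ?_, ?_, ?_, ?_, ?_⟩
  · intro y hy
    rw [hsupp, Finset.mem_insert] at hy
    rcases hy with rfl | hy
    · simp [hv]
    · exact hf.mem_of_mem_support y hy
  · intro y hy
    rw [hsupp]
    exact Finset.mem_insert_of_mem (hf.mem_support y hy)
  · rw [hsupp, filter_insert, if_pos hv, card_insert_of_notMem (by simp [hv']), hf.card_support]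
  · have hss : insert v (innerSteps π f R) ⊆ innerSteps π (f * swap x v) R := by
      refine insert_subset ?_ (hsub R)
      rw [mem_innerSteps, hsupp, happ, if_neg hxv.symm, if_pos rfl]
      exact ⟨by simp, hv, hfxR⟩
    have := card_le_card hss
    rw [card_insert_of_notMem (fun hm => hv' (mem_innerSteps.1 hm).1)] at this
    have := hf.card_le_add
    omega
  · exact fun w hw => (hf.card_le w hw).trans (card_le_card (hsub w))

theorem IsPartialCycle.grow_to (h : G.IsCliqueLinkage π r n)
    (hf : G.IsPartialCycle π r S R d 2 f) (hd : d ≤ 1) (h2 : 2 ≤ k) (hk : k ≤ n) :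
    ∃ f', G.IsPartialCycle π r S R d k f' := by
  induction k, h2 using Nat.le_induction with
  | base => exact ⟨f, hf⟩
  | succ k h2 ih =>
    obtain ⟨f', hf'⟩ := ih (by omega)
    exact hf'.grow h (by omega) (by omega)

theorem IsCliqueLinkage.attach (h : G.IsCliqueLinkage π r n) (hf : G.IsCyclicPerm f) {Q : W}
    {x : V} (hx : x ∈ innerSteps π f Q) (hQR : r Q R) (hR : ∀ y ∈ f.support, π y ≠ R) :
    ∃ f' a b, G.IsCyclicPerm f' ∧ f'.support = insert a (insert b f.support) ∧ a ≠ b ∧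
      a ∉ f.support ∧ b ∉ f.support ∧ π a = R ∧ π b = R ∧
      (∀ w, (innerSteps π f w).erase x ⊆ innerSteps π f' w) ∧ a ∈ innerSteps π f' R := by
  obtain ⟨hxs, hxQ, hfxQ⟩ := mem_innerSteps.1 hx
  obtain ⟨a, b, ha, hb, hab, hxa, hxb⟩ := h.exists_adj (hxQ ▸ hQR) (hxQ.trans hfxQ.symm)
    (hf.2 x hxs).ne
  have ha' : a ∉ f.support := fun hs => hR a hs ha
  have hb' : b ∉ f.support := fun hs => hR b hs hb
  obtain ⟨f', h1, h2, h3, h4⟩ := hf.insert_edge hx ha' hb' (h.adj_of_eq (ha.trans hb.symm) hab)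
    ha hb hxa hxb.symm
  exact ⟨f', a, b, h1, h2, hab, ha', hb', ha, hb, h3, h4⟩

theorem IsFullCycle.exists_isPartialCycle (h : G.IsCliqueLinkage π r n)
    (hf : G.IsFullCycle π r S f) {Q : W} (hQ : Q ∈ S) (hR : R ∉ S) (hQR : r Q R) :
    ∃ f', G.IsPartialCycle π r S R 1 2 f' := by
  classical
  have hpos : 0 < #(innerSteps π f Q) :=
    (card_pos.2 ⟨R, by simp [hQR, hR]⟩).trans_le (hf.card_le Q hQ)
  obtain ⟨x, hx⟩ := card_pos.1 hpos
  obtain ⟨hxs, hxQ, hfxQ⟩ := mem_innerSteps.1 hx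
  have hRs : ∀ y ∈ f.support, π y ≠ R := by
    rintro y hy rfl
    exact hR ((hf.mem_support y).1 hy)
  obtain ⟨f', a, b, hf', hsupp, hab, ha', hb', ha, hb, hsub, haR⟩ :=
    h.attach hf.isCyclicPerm hx hQR hRs
  refine ⟨f', hf', hR, ?_, ?_, ?_, ?_, ?_⟩
  · intro y hy
    rw [hsupp, Finset.mem_insert, Finset.mem_insert] at hy
    rcases hy with rfl | rfl | hy
    · simp [ha]
    · simp [hb]
    · exact Finset.mem_insert_of_mem ((hf.mem_support y).1 hy)
  · intro y hy
    rw [hsupp]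
    exact Finset.mem_insert_of_mem (Finset.mem_insert_of_mem ((hf.mem_support y).2 hy))
  · rw [hsupp, filter_insert, if_pos ha, filter_insert, if_pos hb,
      filter_eq_empty_iff.2 (fun y hy => hRs y hy), card_insert_of_notMem (by simpa using hab)]
    simp
  · have : 0 < #(innerSteps π f' R) := card_pos.2 ⟨a, haR⟩
    omega
  · intro w hw
    refine le_trans ?_ (card_le_card (hsub w))
    have hle := hf.card_le w hw
    -- `Q` loses the inner step at `x`, but also `R` from its neighbours still outside.
    by_cases hwQ : w = Q
    · subst hwQ
      rw [card_erase_of_mem hx]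
      have hlt : #{w' | r w w' ∧ w' ∉ insert R S} < #{w' | r w w' ∧ w' ∉ S} := by
        refine card_lt_card ((ssubset_iff_of_subset ?_).2 ⟨R, by simp [hQR, hR], by simp⟩)
        intro w' hw'
        simp only [mem_filter, mem_univ, true_and, Finset.mem_insert, not_or] at hw' ⊢
        exact ⟨hw'.1, hw'.2.2⟩
      omega
    · rw [erase_eq_of_notMem]
      · refine le_trans (card_le_card fun w' hw' => ?_) hle
        simp only [mem_filter, mem_univ, true_and, Finset.mem_insert, not_or] at hw' ⊢
        exact ⟨hw'.1, hw'.2.2⟩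
      · intro hxw
        exact hwQ ((mem_innerSteps.1 hxw).2.1.symm.trans hxQ)

open Classical in
theorem IsPartialCycle.isFullCycle (h : G.IsCliqueLinkage π r n)
    (hf : G.IsPartialCycle π r S R d n f) (hd : #{w' | r R w' ∧ w' ∉ insert R S} + d ≤ n) :
    G.IsFullCycle π r (insert R S) f := by
  refine ⟨hf.isCyclicPerm, fun y => ⟨hf.mem_of_mem_support y, fun hy => ?_⟩, fun w hw => ?_⟩
  · rcases Finset.mem_insert.1 hy with hy | hy
    · have : ({y ∈ f.support | π y = R} : Finset V) = ({y | π y = R} : Finset V) := by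
        refine eq_of_subset_of_card_le (filter_subset_filter _ (subset_univ _)) ?_
        rw [hf.card_support, h.card_fiber]
      have hm : y ∈ ({y ∈ f.support | π y = R} : Finset V) := by rw [this]; simp [hy]
      exact (mem_filter.1 hm).1
    · exact hf.mem_support y hy
  · rcases Finset.mem_insert.1 hw with rfl | hw
    · have := hf.card_le_add
      omega
    · exact hf.card_le w hw

theorem IsPartialCycle.exists_card_eq (h : G.IsCliqueLinkage π r n)
    (hf : G.IsPartialCycle π r S R d k f) (hd : d < k) (hS : insert R S ≠ univ) :
    ∃ f', G.IsCyclicPerm f' ∧ #f'.support = n * #S + k + 2 := by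
  classical
  obtain ⟨Q, hQ, R', hR', hr⟩ := h.exists_rel (insert R S) (insert_nonempty _ _) hS
  have hpos : 0 < #(innerSteps π f Q) := by
    rcases Finset.mem_insert.1 hQ with rfl | hQ
    · have := hf.card_le_add
      omega
    · exact (card_pos.2 ⟨R', by simpa [hr] using hR'⟩).trans_le (hf.card_le Q hQ)
  obtain ⟨x, hx⟩ := card_pos.1 hpos
  obtain ⟨f', a, b, hf', hsupp, hab, ha', hb', -⟩ := h.attach hf.isCyclicPerm hx hr
    (by rintro y hy rfl; exact hR' (hf.mem_of_mem_support y hy))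
  refine ⟨f', hf', ?_⟩
  rw [hsupp, card_insert_of_notMem (by simp [hab, ha']), card_insert_of_notMem hb',
    hf.card_support_eq h]

open Classical in
theorem IsPartialCycle.extend (h : G.IsCliqueLinkage π r n) (hn : 3 ≤ n)
    (hf : G.IsPartialCycle π r S R d 2 f) (hd : d ≤ 1)
    (hRd : #{w' | r R w' ∧ w' ∉ insert R S} + d ≤ n) :
    (∃ f', G.IsFullCycle π r (insert R S) f') ∧
    (∀ k, n * #S + 2 ≤ k → k ≤ n * #S + n → ∃ f', G.IsCyclicPerm f' ∧ #f'.support = k) ∧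
    (insert R S ≠ univ → ∃ f', G.IsCyclicPerm f' ∧ #f'.support = n * #S + n + 1) := by
  refine ⟨?_, fun k h1 h2 => ?_, fun hS => ?_⟩
  · obtain ⟨f', hf'⟩ := hf.grow_to h hd (k := n) (by omega) le_rfl
    exact ⟨f', hf'.isFullCycle h hRd⟩
  · obtain ⟨f', hf'⟩ := hf.grow_to h hd (k := k - n * #S) (by omega) (by omega)
    refine ⟨f', hf'.isCyclicPerm, ?_⟩
    rw [hf'.card_support_eq h]
    omega
  -- With one vertex of `R` left out, a further edge gives `n - 1 + 2 = n + 1`.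
  · obtain ⟨f', hf'⟩ := hf.grow_to h hd (k := n - 1) (by omega) (by omega)
    obtain ⟨f'', h1, h2⟩ := hf'.exists_card_eq h (by omega) hS
    exact ⟨f'', h1, by omega⟩

theorem IsCliqueLinkage.exists_isPartialCycle_empty (h : G.IsCliqueLinkage π r n) (hn : 2 ≤ n)
    (R : W) : ∃ f, G.IsPartialCycle π r ∅ R 0 2 f := by
  obtain ⟨x, hx, y, hy, hxy⟩ := one_lt_card.1 (hn.trans (h.card_fiber R).ge)
  simp only [mem_filter, mem_univ, true_and] at hx hy
  have hadj := h.adj_of_eq (hx.trans hy.symm) hxy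
  have hsupp := support_swap hxy
  have hR : ∀ z ∈ (swap x y).support, π z = R := by
    intro z hz
    rw [hsupp, Finset.mem_insert, Finset.mem_singleton] at hz
    rcases hz with rfl | rfl <;> assumption
  refine ⟨swap x y, ⟨isCycle_swap hxy, fun z hz => ?_⟩, by simp, fun z hz => by simp [hR z hz],
    by simp, ?_, ?_, by simp⟩
  · rw [hsupp, Finset.mem_insert, Finset.mem_singleton] at hz
    rcases hz with rfl | rfl
    · simpa using hadj
    · simpa using hadj.symm
  · rw [filter_eq_self.2 hR, card_support_swap hxy]
  · rw [innerSteps, filter_eq_self.2 fun z hz => ⟨hR z hz, hR _ (apply_mem_support.2 hz)⟩,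
      card_support_swap hxy]

/-- A graph whose vertices are partitioned into suitably linked cliques has cycles of all
lengths. -/
theorem IsCliqueLinkage.exists_isCyclicPerm [Nonempty W] (h : G.IsCliqueLinkage π r n)
    (hn : 3 ≤ n) {k : ℕ} (hk : 2 ≤ k) (hkV : k ≤ Fintype.card V) :
    ∃ f, G.IsCyclicPerm f ∧ #f.support = k := by
  classical
  have key : ∀ t, 1 ≤ t → t ≤ Fintype.card W → ∃ S f, #S = t ∧ G.IsFullCycle π r S f ∧
      (∀ k, 2 ≤ k → k ≤ n * t → ∃ f', G.IsCyclicPerm f' ∧ #f'.support = k) ∧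
      (S ≠ univ → ∃ f', G.IsCyclicPerm f' ∧ #f'.support = n * t + 1) := by
    intro t ht
    induction t, ht using Nat.le_induction with
    | base =>
      intro _
      obtain ⟨R⟩ := ‹Nonempty W›
      obtain ⟨f, hf⟩ := h.exists_isPartialCycle_empty (by omega) R
      have hdeg : #{w' | r R w' ∧ w' ∉ insert R (∅ : Finset W)} + 0 ≤ n :=
        (card_le_card fun w' hw' => by simp_all).trans (h.degree_le R)
      obtain ⟨⟨f', hf'⟩, h2, h3⟩ := hf.extend h hn (by omega) hdeg
      exact ⟨insert R ∅, f', by simp, hf', by simpa using h2, by simpa using h3⟩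
    | succ t ht ih =>
      intro htW
      obtain ⟨S, f, hS, hf, h1, h2⟩ := ih (by omega)
      have hSu : S ≠ univ := by
        rintro rfl
        rw [card_univ] at hS
        omega
      obtain ⟨Q, hQ, R, hR, hr⟩ := h.exists_rel S (card_pos.1 (by omega)) hSu
      obtain ⟨f₁, hf₁⟩ := hf.exists_isPartialCycle h hQ hR hr
      -- The neighbour `Q` in `S` pays for the one step that leaves `R`; the first clique has `d =
      -- 0` and needs no such saving.
      have hdeg : #{w' | r R w' ∧ w' ∉ insert R S} + 1 ≤ n := by
        refine le_trans (Nat.succ_le_of_lt (card_lt_card ?_)) (h.degree_le R)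
        refine (ssubset_iff_of_subset ?_).2 ⟨Q, by simp [h.symm hr], by simp [hQ]⟩
        intro w' hw'
        simp only [mem_filter, mem_univ, true_and] at hw' ⊢
        exact hw'.1
      obtain ⟨⟨f', hf'⟩, h3, h4⟩ := hf₁.extend h hn le_rfl hdeg
      rw [hS] at h3 h4
      refine ⟨insert R S, f', by rw [card_insert_of_notMem hR, hS], hf', fun k hk2 hk => ?_, ?_⟩
      · rw [mul_add, mul_one] at hk
        rcases lt_trichotomy k (n * t + 1) with hlt | rfl | hgt
        · exact h1 k hk2 (by omega)
        · exact h2 hSu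
        · exact h3 k hgt hk
      · rwa [mul_add, mul_one]
  have hcard : Fintype.card V = n * Fintype.card W := by
    simpa using h.card_preimage univ
  obtain ⟨S, f, -, -, h1, -⟩ := key (Fintype.card W) Fintype.card_pos le_rfl
  exact h1 k hk (hcard ▸ hkV)

end SimpleGraph

/-! ### The cosets of the translations in the derangement graph. -/

open Equiv Equiv.Perm

/-- The group of translations of `Fin (m + 1)`. -/
def translationSubgroup (m : ℕ) : Subgroup (Perm (Fin (m + 1))) where
  carrier := Set.range Equiv.addRight
  one_mem' := ⟨0, by ext; simp⟩
  mul_mem' := by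
    rintro _ _ ⟨a, rfl⟩ ⟨b, rfl⟩
    exact ⟨b + a, by ext; simp [add_assoc]⟩
  inv_mem' := by
    rintro _ ⟨a, rfl⟩
    exact ⟨-a, by ext; simp⟩

theorem mk_eq_mk_translationSubgroup {m : ℕ} {g h : Perm (Fin (m + 1))} :
    (g : Perm (Fin (m + 1)) ⧸ translationSubgroup m) = h ↔ ∃ a, h = g * Equiv.addRight a := by
  rw [QuotientGroup.eq]
  constructor
  · rintro ⟨a, ha⟩
    exact ⟨a, by rw [ha]; group⟩
  · rintro ⟨a, rfl⟩
    exact ⟨a, by group⟩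

/-- Two cosets of the group of translations are linked if a transposition of cyclically adjacent
points leads from one to the other. -/
def CosetLink (m : ℕ) (q q' : Perm (Fin (m + 1)) ⧸ translationSubgroup m) : Prop :=
  ∃ (g : Perm (Fin (m + 1))) (i : Fin (m + 1)), (g : _ ⧸ translationSubgroup m) = q ∧
    ((g * swap i (i + 1) : Perm (Fin (m + 1))) : _ ⧸ translationSubgroup m) = q'

theorem addRight_mul_swap {m : ℕ} (a i : Fin (m + 1)) :
    Equiv.addRight a * swap i (i + 1) = swap (i + a) (i + a + 1) * Equiv.addRight a := by
  rw [Equiv.mul_swap_eq_swap_mul]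
  simp [add_right_comm]

/-- Conjugation by a translation permutes the cyclically adjacent transpositions, so any
representative can be used. -/
theorem CosetLink.exists_swap {m : ℕ} {g : Perm (Fin (m + 1))}
    {q : Perm (Fin (m + 1)) ⧸ translationSubgroup m} (h : CosetLink m g q) :
    ∃ i, ((g * swap i (i + 1) : Perm (Fin (m + 1))) : _ ⧸ translationSubgroup m) = q := by
  obtain ⟨g', i, hg, rfl⟩ := h
  obtain ⟨a, rfl⟩ := mk_eq_mk_translationSubgroup.1 hg.symm
  refine ⟨i + a, mk_eq_mk_translationSubgroup.2 ⟨a, ?_⟩⟩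
  rw [mul_assoc, mul_assoc, addRight_mul_swap]

-- A transposition of neighbours shifts a point by at most one, so after a shift by 2 the total
-- shift is 1, 2 or 3, nonzero since there are at least four points.
open Fin.NatCast Fin.CommRing in
theorem Fin.add_two_ne_swap_apply {m : ℕ} (hm : 3 ≤ m) (i y : Fin (m + 1)) :
    swap i (i + 1) (y + (1 + 1)) ≠ y := by
  have hcast : ∀ k : ℕ, 0 < k → k ≤ 3 → ((k : ℕ) : Fin (m + 1)) ≠ 0 := by
    intro k hk hk3 h
    have := Nat.le_of_dvd hk (Fin.natCast_eq_zero.1 h)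
    omega
  have h1 : (1 : Fin (m + 1)) ≠ 0 := by simpa using hcast 1 (by omega) (by omega)
  have h2 : (1 + 1 : Fin (m + 1)) ≠ 0 := by
    simpa only [Nat.cast_add, Nat.cast_one] using hcast (1 + 1) (by omega) (by omega)
  have h3 : (1 + 1 + 1 : Fin (m + 1)) ≠ 0 := by
    simpa only [Nat.cast_add, Nat.cast_one] using hcast (1 + 1 + 1) (by omega) (by omega)
  rw [swap_apply_def]
  split_ifs with h h' <;> intro e
  · rw [← h, add_assoc] at e
    exact h3 (by simpa using e)
  · rw [← e, ← add_assoc] at h'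
    exact h1 (by simpa using h')
  · exact h2 (by simpa using e)

open Classical in
theorem isCliqueLinkage_derangementGraph {m : ℕ} (hm : 3 ≤ m) :
    (derangementGraph (m + 1)).IsCliqueLinkage
      (fun g => (g : Perm (Fin (m + 1)) ⧸ translationSubgroup m)) (CosetLink m) (m + 1) where
  card_fiber q := by
    obtain ⟨g, rfl⟩ := QuotientGroup.mk_surjective q
    refine Eq.trans (Eq.symm ?_) (Finset.card_fin (m + 1))
    refine Finset.card_bij (fun a _ => g * Equiv.addRight a) ?_ ?_ ?_
    · intro a _
      simpa using (mk_eq_mk_translationSubgroup.2 ⟨a, rfl⟩).symm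
    · intro a _ b _ hab
      have := DFunLike.congr_fun (mul_left_cancel hab) 0
      simpa using this
    · intro h hh
      obtain ⟨a, rfl⟩ := mk_eq_mk_translationSubgroup.1 (by simpa using hh : (h : _ ⧸ _) = g).symm
      exact ⟨a, Finset.mem_univ _, rfl⟩
  adj_of_eq := by
    intro u v huv hne
    obtain ⟨a, rfl⟩ := mk_eq_mk_translationSubgroup.1 huv
    rw [derangementGraph_adj (Nat.succ_pos m)]
    intro i hi
    have ha : a = 0 := by simpa using u.injective hi
    subst ha
    exact hne (by ext; simp)
  symm := by
    rintro _ _ ⟨g, i, rfl, rfl⟩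
    exact ⟨g * swap i (i + 1), i, rfl, by simp [mul_assoc]⟩
  degree_le q := by
    obtain ⟨g, rfl⟩ := QuotientGroup.mk_surjective q
    calc _ ≤ (Finset.univ.image fun i : Fin (m + 1) =>
          ((g * swap i (i + 1) : Perm (Fin (m + 1))) : _ ⧸ translationSubgroup m)).card := by
          refine Finset.card_le_card fun q hq => ?_
          obtain ⟨i, hi⟩ := (Finset.mem_filter.1 hq).2.exists_swap
          exact Finset.mem_image.2 ⟨i, Finset.mem_univ _, hi⟩
      _ ≤ m + 1 := Finset.card_image_le.trans (by simp)
  exists_rel S hS hSu := by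
    by_contra! hcon
    apply hSu
    obtain ⟨q, hq⟩ := hS
    obtain ⟨g₀, rfl⟩ := QuotientGroup.mk_surjective q
    have key : ∀ p : Perm (Fin (m + 1)), ∀ g : Perm (Fin (m + 1)),
        (g : _ ⧸ translationSubgroup m) ∈ S →
        ((g * p : Perm (Fin (m + 1))) : _ ⧸ translationSubgroup m) ∈ S := by
      intro p
      have hp : p ∈ Submonoid.closure (Set.range fun i : Fin m ↦ swap i.castSucc i.succ) := by
        rw [mclosure_swap_castSucc_succ]; trivial
      induction hp using Submonoid.closure_induction with
      | mem p hp =>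
        obtain ⟨i, rfl⟩ := hp
        intro g hg
        by_contra hn
        refine hcon _ hg _ hn ⟨g, i.castSucc, rfl, ?_⟩
        rw [Fin.coeSucc_eq_succ]
      | one => simp
      | mul p p' _ _ h1 h2 =>
        intro g hg
        rw [← mul_assoc]
        exact h2 _ (h1 _ hg)
    rw [Finset.eq_univ_iff_forall]
    intro q
    obtain ⟨g, rfl⟩ := QuotientGroup.mk_surjective q
    simpa using key (g₀⁻¹ * g) g₀ hq
  exists_adj := by
    intro R x y hr hxy hne
    obtain ⟨i, rfl⟩ := hr.exists_swap
    obtain ⟨a, rfl⟩ := mk_eq_mk_translationSubgroup.1 hxy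
    have hadj : ∀ (g : Perm (Fin (m + 1))) (j : Fin (m + 1)), (derangementGraph (m + 1)).Adj g
        (g * swap j (j + 1) * Equiv.addRight (1 + 1)) := by
      intro g j
      rw [derangementGraph_adj (Nat.succ_pos m)]
      intro y hy
      exact Fin.add_two_ne_swap_apply hm j y (g.injective hy).symm
    -- The index `i - a` puts the neighbour of the second vertex in the same coset as that of `x`, a
    -- translation by `a` away from it.
    have hya : x * Equiv.addRight a * swap (i - a) (i - a + 1) * Equiv.addRight (1 + 1) =
        x * swap i (i + 1) * Equiv.addRight (a + (1 + 1)) := by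
      rw [mul_assoc x, addRight_mul_swap, sub_add_cancel]
      ext
      simp [add_comm a (1 + 1), add_assoc]
    refine ⟨_, _, ?_, ?_, ?_, hadj x i, hadj _ (i - a)⟩
    · exact (mk_eq_mk_translationSubgroup.2 ⟨1 + 1, rfl⟩).symm
    · exact (mk_eq_mk_translationSubgroup.2 ⟨a + (1 + 1), hya⟩).symm
    · rw [hya]
      intro h
      have := DFunLike.congr_fun (mul_left_cancel h) 0
      have ha : a = 0 := by simpa using this
      subst ha
      exact hne (by ext; simp)

/-- Left multiplication is an endomorphism of the derangement graph. -/
def derangementGraphMulLeft {n : ℕ} (hn : 0 < n) (t : Perm (Fin n)) :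
    derangementGraph n →g derangementGraph n where
  toFun g := t * g
  map_rel' := by
    intro g h hgh
    rw [derangementGraph_adj hn] at hgh ⊢
    exact fun i hi => hgh i (t.injective hi)

theorem corollary1p2 (n : ℕ) (hn : 4 ≤ n) :
    (derangementGraph n).IsVertexPancyclic ∧ (derangementGraph n).IsPancyclic := by
  classical
  obtain ⟨m, rfl⟩ : ∃ m, n = m + 1 := ⟨n - 1, by omega⟩
  have hcard : 3 ≤ Fintype.card (Perm (Fin (m + 1))) := by
    rw [Fintype.card_perm, Fintype.card_fin]
    exact le_trans (by omega) (Nat.self_le_factorial (m + 1))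
  have hcyc : ∀ k, 3 ≤ k → k ≤ Fintype.card (Perm (Fin (m + 1))) →
      ∃ (u : _) (c : (derangementGraph (m + 1)).Walk u u), c.IsCycle ∧ c.length = k := by
    intro k h3 hk
    obtain ⟨f, hf, rfl⟩ := (isCliqueLinkage_derangementGraph (m := m) (by omega)).exists_isCyclicPerm
      (by omega) (by omega) hk
    exact hf.exists_isCycle h3
  refine ⟨⟨hcard, fun v k h3 hk => ?_⟩, hcard, hcyc⟩
  obtain ⟨u, c, hc, hl⟩ := hcyc k h3 hk
  have hv : derangementGraphMulLeft (Nat.succ_pos m) (v * u⁻¹) u = v :=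
    inv_mul_cancel_right v u
  refine ⟨_, c.map (derangementGraphMulLeft (Nat.succ_pos m) (v * u⁻¹)), hc.map ?_, by simpa, ?_⟩
  · exact mul_right_injective (v * u⁻¹)
  · rw [SimpleGraph.Walk.support_map, List.mem_map]
    exact ⟨u, c.start_mem_support, hv⟩
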